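/- **Corollary (strong normalization of $\overline{\lambda}\mu\tilde{\mu}^*$ and $\overline{\lambda}\mu\tilde{\mu}$).** Fix a set $\mathcal A$ of atomic types. The types of the $\overline{\lambda}\mu\tilde{\mu}^*$-calculus are generated from atomic types by $A\to B$ and $A^\bot$, and are identified modulo the congruence generated by $(A^\bot)^\bot=A$. There are two kinds of variables, $l$-variables $x,y,\dots$ and $r$-variables $\alpha,\beta,\dots$, and three kinds of terms (up to renaming of bound variables), $c$-terms $p$, $l$-terms $t$ and $r$-terms $e$: $$p ::= \lfloor t,e\rfloor,\qquad t ::= x \mid \lambda x\,t \mid \mu\alpha\,p \mid \overline{e},\qquad e ::= \alpha \mid (t.e) \mid \tilde\mu x\,p \mid \widetilde{t}.$$ Let $\Gamma$ and $\triangle$ range over finite sets of declarations $x:A$ and $\alpha:A$ respectively, with each variable declared at most once. The judgements $\Gamma\rhd t:A\,|\,\triangle$, $\;\Gamma\,|\,e:A\rhd\triangle$ and $p:(\Gamma\rhd\triangle)$ are derived by the rules $$\frac{}{\Gamma,x:A\rhd x:A\,|\,\triangle}\qquad \frac{}{\Gamma\,|\,\alpha:A\rhd\alpha:A,\triangle}\qquad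 \frac{\Gamma,x:A\rhd t:B\,|\,\triangle}{\Gamma\rhd\lambda x\,t:A\to B\,|\,\triangle}\qquad \frac{\Gamma\rhd t:A\,|\,\triangle\quad \Gamma\,|\,e:B\rhd\triangle}{\Gamma\,|\,(t.e):A\to B\rhd\triangle}$$ $$\frac{\Gamma\rhd t:A\,|\,\triangle\quad \Gamma\,|\,e:A\rhd\triangle}{\lfloor t,e\rfloor:(\Gamma\rhd\triangle)}\qquad \frac{p:(\Gamma\rhd\alpha:A,\triangle)}{\Gamma\rhd\mu\alpha\,p:A\,|\,\triangle}\qquad \frac{p:(\Gamma,x:A\rhd\triangle)}{\Gamma\,|\,\tilde\mu x\,p:A\rhd\triangle}$$ $$\frac{\Gamma\,|\,e:A\rhd\triangle}{\Gamma\rhd\overline{e}:A^\bot\,|\,\triangle}\qquad \frac{\Gamma\rhd t:A\,|\,\triangle}{\Gamma\,|\,\widetilde{t}:A^\bot\rhd\triangle}.$$ One-step reduction $\hookrightarrow$ is the compatible closure of the union of the rules $$\lfloor\lambda x\,t,(t'.e)\rfloor\hookrightarrow\lfloor t',\tilde\mu x\lfloor t,e\rfloor\rfloor\ \ (x\notin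 Fv(e)),\qquad \lfloor\mu\alpha\,p,e\rfloor\hookrightarrow p[\alpha:=e],\qquad \lfloor t,\tilde\mu x\,p\rfloor\hookrightarrow p[x:=t],$$ $$\mu\alpha\lfloor t,\alpha\rfloor\hookrightarrow t\ \ (\alpha\notin Fv(t)),\qquad \tilde\mu x\lfloor x,e\rfloor\hookrightarrow e\ \ (x\notin Fv(e)),$$ $$\overline{\widetilde{t}}\hookrightarrow t,\qquad \widetilde{\overline{e}}\hookrightarrow e,\qquad \lfloor\overline{e},\widetilde{t}\rfloor\hookrightarrow\lfloor t,e\rfloor .$$ The $\overline{\lambda}\mu\tilde{\mu}$-calculus (implicational part) is obtained by omitting $A^\bot$, $\overline{e}$, $\widetilde{t}$ and the typing and reduction rules that mention them. Then every typed term of the $\overline{\lambda}\mu\tilde{\mu}^*$-calculus is strongly normalizable: if $\Gamma\rhd t:A\,|\,\triangle$ (resp. $\Gamma\,|\,e:A\rhd\triangle$, resp. $p:(\Gamma\rhd\triangle)$), then every $\hookrightarrow$-reduction sequence starting from $t$ (resp. $e$, resp. $p$) is finite. The same holds for every typed term of the $\overline{\lambda}\mu\tilde{\mu}$-calculus. 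-/

import Mathlib

/-! Two calculi are defined at once: the `λμμ̃`-calculus of Curien and Herbelin (implicational part)
and its extension `λμμ̃*` with an involutive negation. Everything that exists only in the extension
is indexed by `Calculus.star`. Terms are taken up to renaming of bound variables: they are
represented with de Bruijn indices, `l`-variables and `r`-variables being numbered separately. -/

namespace LMM

universe u

/-- `base` is `λμμ̃`, `star` is `λμμ̃*`. -/
inductive Calculus : Type
  | base
  | star

/-- The three kinds of terms: `l`-terms `t`, `r`-terms `e`, `c`-terms `p`. -/
inductive Kind : Type
  | l
  | r
  | c

/-! ### Types -/

/-- Type expressions: atomic types, arrows and (in `λμμ̃*` only) negations. -/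
inductive PreTy (𝒜 : Type u) : Calculus → Type u
  | atom {s : Calculus} (a : 𝒜) : PreTy 𝒜 s
  | arr {s : Calculus} (A B : PreTy 𝒜 s) : PreTy 𝒜 s
  | neg (A : PreTy 𝒜 .star) : PreTy 𝒜 .star

/-- One use of the equation `(A^⊥)^⊥ = A` inside a type expression. -/
inductive PreTy.Rel {𝒜 : Type u} : {s : Calculus} → PreTy 𝒜 s → PreTy 𝒜 s → Prop
  | neg_neg (A : PreTy 𝒜 .star) : PreTy.Rel (.neg (.neg A)) A
  | neg {A A' : PreTy 𝒜 .star} (h : PreTy.Rel A A') : PreTy.Rel (.neg A) (.neg A')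
  | arr_left {s : Calculus} {A A' : PreTy 𝒜 s} (B : PreTy 𝒜 s) (h : PreTy.Rel A A') :
      PreTy.Rel (.arr A B) (.arr A' B)
  | arr_right {s : Calculus} (A : PreTy 𝒜 s) {B B' : PreTy 𝒜 s} (h : PreTy.Rel B B') :
      PreTy.Rel (.arr A B) (.arr A B')

/-- Types: type expressions modulo the congruence generated by `(A^⊥)^⊥ = A`
(`Quot` divides by the equivalence relation that `PreTy.Rel` generates). -/
def Ty (𝒜 : Type u) (s : Calculus) : Type u := Quot (PreTy.Rel (𝒜 := 𝒜) (s := s))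

namespace Ty

variable {𝒜 : Type u} {s : Calculus}

def atom (a : 𝒜) : Ty 𝒜 s := Quot.mk _ (.atom a)

def arr : Ty 𝒜 s → Ty 𝒜 s → Ty 𝒜 s :=
  Quot.map₂ PreTy.arr (fun A _ _ h => .arr_right A h) (fun _ _ B h => .arr_left B h)

def neg : Ty 𝒜 .star → Ty 𝒜 .star :=
  Quot.map PreTy.neg (fun _ _ h => .neg h)

theorem neg_neg (A : Ty 𝒜 .star) : neg (neg A) = A := by
  induction A using Quot.ind with
  | _ A => exact Quot.sound (.neg_neg A)

end Ty

/-! ### Terms -/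

/-- Terms. `lam` and `mutilde` (that is, `μ̃`) bind the `l`-variable `0` of their body,
`mu` binds the `r`-variable `0`. -/
inductive Tm : Calculus → Kind → Type
  /-- `⌊t, e⌋` -/
  | cut {s : Calculus} (t : Tm s .l) (e : Tm s .r) : Tm s .c
  /-- an `l`-variable `x` -/
  | lvar {s : Calculus} (x : ℕ) : Tm s .l
  /-- `λx t` -/
  | lam {s : Calculus} (t : Tm s .l) : Tm s .l
  /-- `μα p` -/
  | mu {s : Calculus} (p : Tm s .c) : Tm s .l
  /-- `e̅`, in `λμμ̃*` only -/
  | bar (e : Tm .star .r) : Tm .star .l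
  /-- an `r`-variable `α` -/
  | rvar {s : Calculus} (a : ℕ) : Tm s .r
  /-- `(t.e)` -/
  | app {s : Calculus} (t : Tm s .l) (e : Tm s .r) : Tm s .r
  /-- `μ̃x p` -/
  | mutilde {s : Calculus} (p : Tm s .c) : Tm s .r
  /-- `t̃`, in `λμμ̃*` only -/
  | tilde (t : Tm .star .l) : Tm .star .r

/-- The renaming `ρ` pushed under a binder. -/
def upRen (ρ : ℕ → ℕ) : ℕ → ℕ
  | 0 => 0
  | n + 1 => ρ n + 1

namespace Tm

/-- Rename the free `l`-variables by `ρ` and the free `r`-variables by `θ`. -/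
def rename : {s : Calculus} → {k : Kind} → (ρ θ : ℕ → ℕ) → Tm s k → Tm s k
  | _, _, ρ, θ, cut t e => cut (rename ρ θ t) (rename ρ θ e)
  | _, _, ρ, _, lvar x => lvar (ρ x)
  | _, _, ρ, θ, lam t => lam (rename (upRen ρ) θ t)
  | _, _, ρ, θ, mu p => mu (rename ρ (upRen θ) p)
  | _, _, ρ, θ, bar e => bar (rename ρ θ e)
  | _, _, _, θ, rvar a => rvar (θ a)
  | _, _, ρ, θ, app t e => app (rename ρ θ t) (rename ρ θ e)
  | _, _, ρ, θ, mutilde p => mutilde (rename (upRen ρ) θ p)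
  | _, _, ρ, θ, tilde t => tilde (rename ρ θ t)

variable {s : Calculus} {k : Kind}

/-- `u` weakened by a fresh `l`-variable `0`. The terms of the form `shiftL u` are
exactly those in which the `l`-variable `0` is not free. -/
def shiftL (u : Tm s k) : Tm s k := rename Nat.succ id u

/-- `u` weakened by a fresh `r`-variable `0`. The terms of the form `shiftR u` are
exactly those in which the `r`-variable `0` is not free. -/
def shiftR (u : Tm s k) : Tm s k := rename id Nat.succ u

/-- The sequence `u, f 0, f 1, …`. -/
def scons (u : Tm s k) (f : ℕ → Tm s k) : ℕ → Tm s k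
  | 0 => u
  | n + 1 => f n

/-- Simultaneous capture-avoiding substitution of `σ` for the `l`-variables and `τ` for the
`r`-variables. -/
def subst : {s : Calculus} → {k : Kind} → (σ : ℕ → Tm s .l) → (τ : ℕ → Tm s .r) → Tm s k → Tm s k
  | _, _, σ, τ, cut t e => cut (subst σ τ t) (subst σ τ e)
  | _, _, σ, _, lvar x => σ x
  | _, _, σ, τ, lam t =>
      lam (subst (scons (lvar 0) fun n => shiftL (σ n)) (fun n => shiftL (τ n)) t)
  | _, _, σ, τ, mu p =>
      mu (subst (fun n => shiftR (σ n)) (scons (rvar 0) fun n => shiftR (τ n)) p)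
  | _, _, σ, τ, bar e => bar (subst σ τ e)
  | _, _, _, τ, rvar a => τ a
  | _, _, σ, τ, app t e => app (subst σ τ t) (subst σ τ e)
  | _, _, σ, τ, mutilde p =>
      mutilde (subst (scons (lvar 0) fun n => shiftL (σ n)) (fun n => shiftL (τ n)) p)
  | _, _, σ, τ, tilde t => tilde (subst σ τ t)

/-- `u[x := t]`, where `x` is the `l`-variable `0` (which disappears). -/
def instL (u : Tm s k) (t : Tm s .l) : Tm s k := subst (scons t lvar) rvar u

/-- `u[α := e]`, where `α` is the `r`-variable `0` (which disappears). -/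
def instR (u : Tm s k) (e : Tm s .r) : Tm s k := subst lvar (scons e rvar) u

end Tm

/-! ### Typing -/

/-- Contexts: the variable with index `n` is declared with the `n`-th type of the list. -/
abbrev Ctx (𝒜 : Type u) (s : Calculus) : Type u := List (Ty 𝒜 s)

mutual

/-- `Γ ▷ t : A | Δ` -/
inductive TypedL {𝒜 : Type u} : {s : Calculus} → Ctx 𝒜 s → Tm s .l → Ty 𝒜 s → Ctx 𝒜 s → Prop
  | var {s : Calculus} {Γ Δ : Ctx 𝒜 s} {x : ℕ} {A : Ty 𝒜 s} (h : Γ[x]? = some A) :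
      TypedL Γ (.lvar x) A Δ
  | lam {s : Calculus} {Γ Δ : Ctx 𝒜 s} {t : Tm s .l} {A B : Ty 𝒜 s} (h : TypedL (A :: Γ) t B Δ) :
      TypedL Γ (.lam t) (.arr A B) Δ
  | mu {s : Calculus} {Γ Δ : Ctx 𝒜 s} {p : Tm s .c} {A : Ty 𝒜 s} (h : TypedC p Γ (A :: Δ)) :
      TypedL Γ (.mu p) A Δ
  | bar {Γ Δ : Ctx 𝒜 .star} {e : Tm .star .r} {A : Ty 𝒜 .star} (h : TypedR Γ e A Δ) :
      TypedL Γ (.bar e) (.neg A) Δ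

/-- `Γ | e : A ▷ Δ` -/
inductive TypedR {𝒜 : Type u} : {s : Calculus} → Ctx 𝒜 s → Tm s .r → Ty 𝒜 s → Ctx 𝒜 s → Prop
  | var {s : Calculus} {Γ Δ : Ctx 𝒜 s} {a : ℕ} {A : Ty 𝒜 s} (h : Δ[a]? = some A) :
      TypedR Γ (.rvar a) A Δ
  | app {s : Calculus} {Γ Δ : Ctx 𝒜 s} {t : Tm s .l} {e : Tm s .r} {A B : Ty 𝒜 s}
      (ht : TypedL Γ t A Δ) (he : TypedR Γ e B Δ) : TypedR Γ (.app t e) (.arr A B) Δ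
  | mutilde {s : Calculus} {Γ Δ : Ctx 𝒜 s} {p : Tm s .c} {A : Ty 𝒜 s} (h : TypedC p (A :: Γ) Δ) :
      TypedR Γ (.mutilde p) A Δ
  | tilde {Γ Δ : Ctx 𝒜 .star} {t : Tm .star .l} {A : Ty 𝒜 .star} (h : TypedL Γ t A Δ) :
      TypedR Γ (.tilde t) (.neg A) Δ

/-- `p : (Γ ▷ Δ)` -/
inductive TypedC {𝒜 : Type u} : {s : Calculus} → Tm s .c → Ctx 𝒜 s → Ctx 𝒜 s → Prop
  | cut {s : Calculus} {Γ Δ : Ctx 𝒜 s} {t : Tm s .l} {e : Tm s .r} {A : Ty 𝒜 s}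
      (ht : TypedL Γ t A Δ) (he : TypedR Γ e A Δ) : TypedC (.cut t e) Γ Δ

end

/-! ### Reduction -/

open Tm in
/-- The reduction rules; the last three exist in `λμμ̃*` only. -/
inductive Root : {s : Calculus} → {k : Kind} → Tm s k → Tm s k → Prop
  | lam {s : Calculus} (t t' : Tm s .l) (e : Tm s .r) :
      Root (cut (lam t) (app t' e)) (cut t' (mutilde (cut t (shiftL e))))
  | mu {s : Calculus} (p : Tm s .c) (e : Tm s .r) : Root (cut (mu p) e) (instR p e)
  | mutilde {s : Calculus} (t : Tm s .l) (p : Tm s .c) : Root (cut t (mutilde p)) (instL p t)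
  | sl {s : Calculus} (t : Tm s .l) : Root (mu (cut (shiftR t) (rvar 0))) t
  | sr {s : Calculus} (e : Tm s .r) : Root (mutilde (cut (lvar 0) (shiftL e))) e
  | cl1l (t : Tm .star .l) : Root (bar (tilde t)) t
  | cl1r (e : Tm .star .r) : Root (tilde (bar e)) e
  | cl2 (t : Tm .star .l) (e : Tm .star .r) : Root (cut (bar e) (tilde t)) (cut t e)

open Tm in
/-- One-step reduction: the compatible closure of the union of the rules. -/
inductive Step : {s : Calculus} → {k : Kind} → Tm s k → Tm s k → Prop
  | root {s : Calculus} {k : Kind} {u v : Tm s k} (h : Root u v) : Step u v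
  | cut_left {s : Calculus} {t t' : Tm s .l} (e : Tm s .r) (h : Step t t') :
      Step (cut t e) (cut t' e)
  | cut_right {s : Calculus} (t : Tm s .l) {e e' : Tm s .r} (h : Step e e') :
      Step (cut t e) (cut t e')
  | lam {s : Calculus} {t t' : Tm s .l} (h : Step t t') : Step (lam t) (lam t')
  | mu {s : Calculus} {p p' : Tm s .c} (h : Step p p') : Step (mu p) (mu p')
  | bar {e e' : Tm .star .r} (h : Step e e') : Step (bar e) (bar e')
  | app_left {s : Calculus} {t t' : Tm s .l} (e : Tm s .r) (h : Step t t') :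
      Step (app t e) (app t' e)
  | app_right {s : Calculus} (t : Tm s .l) {e e' : Tm s .r} (h : Step e e') :
      Step (app t e) (app t e')
  | mutilde {s : Calculus} {p p' : Tm s .c} (h : Step p p') : Step (mutilde p) (mutilde p')
  | tilde {t t' : Tm .star .l} (h : Step t t') : Step (tilde t) (tilde t')

/-- Strong normalizability: every reduction sequence starting from `u` is finite. -/
def StronglyNormalizable {s : Calculus} {k : Kind} (u : Tm s k) : Prop :=
  ¬ ∃ f : ℕ → Tm s k, f 0 = u ∧ ∀ n, Step (f n) (f (n + 1))

/-- Every typed term of the calculus `s`, of any of the three kinds, is strongly normalizable. -/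
def CalculusStronglyNormalizable (𝒜 : Type u) (s : Calculus) : Prop :=
  (∀ (Γ Δ : Ctx 𝒜 s) (t : Tm s .l) (A : Ty 𝒜 s), TypedL Γ t A Δ → StronglyNormalizable t) ∧
  (∀ (Γ Δ : Ctx 𝒜 s) (e : Tm s .r) (A : Ty 𝒜 s), TypedR Γ e A Δ → StronglyNormalizable e) ∧
  (∀ (Γ Δ : Ctx 𝒜 s) (p : Tm s .c), TypedC p Γ Δ → StronglyNormalizable p)

end LMM

/-! Strong normalization is proved for a one-sorted symmetric calculus into which both calculi
are translated by erasing the two negation constructors; its typed terms are handled by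
symmetric reducibility candidates, obtained as fixed points. -/

namespace LMM

universe u

/-! ### A one-sorted symmetric calculus -/

/-- Terms of the symmetric calculus; `lam` and `mu` bind the variable `0`. -/
inductive SymTm : Type
  | var (n : ℕ)
  | lam (t : SymTm)
  | mu (p : SymTm)
  | pair (t e : SymTm)
  | cut (t e : SymTm)

namespace SymTm

def rename : (ℕ → ℕ) → SymTm → SymTm
  | ρ, var n => var (ρ n)
  | ρ, lam t => lam (rename (upRen ρ) t)
  | ρ, mu p => mu (rename (upRen ρ) p)
  | ρ, pair t e => pair (rename ρ t) (rename ρ e)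
  | ρ, cut t e => cut (rename ρ t) (rename ρ e)

def shift (u : SymTm) : SymTm := rename Nat.succ u

def scons (u : SymTm) (f : ℕ → SymTm) : ℕ → SymTm
  | 0 => u
  | n + 1 => f n

/-- The substitution `σ` pushed under a binder. -/
def up (σ : ℕ → SymTm) : ℕ → SymTm := scons (var 0) fun n => shift (σ n)

def subst : (ℕ → SymTm) → SymTm → SymTm
  | σ, var n => σ n
  | σ, lam t => lam (subst (up σ) t)
  | σ, mu p => mu (subst (up σ) p)
  | σ, pair t e => pair (subst σ t) (subst σ e)
  | σ, cut t e => cut (subst σ t) (subst σ e)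

def inst (p v : SymTm) : SymTm := subst (scons v var) p

theorem rename_rename (ρ ρ' : ℕ → ℕ) (u : SymTm) :
    rename ρ (rename ρ' u) = rename (fun n => ρ (ρ' n)) u := by
  have key : ∀ ρ ρ' : ℕ → ℕ,
      (fun n => upRen ρ (upRen ρ' n)) = upRen fun n => ρ (ρ' n) := by
    intro ρ ρ'; funext n; cases n <;> rfl
  induction u generalizing ρ ρ' with
  | var n => rfl
  | lam t ih => simp only [rename, ih, key]
  | mu t ih => simp only [rename, ih, key]
  | pair t e iht ihe => simp only [rename, iht, ihe]
  | cut t e iht ihe => simp only [rename, iht, ihe]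

theorem rename_shift (ρ : ℕ → ℕ) (u : SymTm) :
    rename (upRen ρ) (shift u) = shift (rename ρ u) := by
  simp only [shift, rename_rename]; rfl

theorem up_upRen (σ : ℕ → SymTm) (ρ : ℕ → ℕ) :
    (fun n => up σ (upRen ρ n)) = up fun n => σ (ρ n) := by
  funext n; cases n <;> rfl

theorem subst_rename (σ : ℕ → SymTm) (ρ : ℕ → ℕ) (u : SymTm) :
    subst σ (rename ρ u) = subst (fun n => σ (ρ n)) u := by
  induction u generalizing σ ρ with
  | var n => rfl
  | lam t ih => simp only [rename, subst, ih, up_upRen]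
  | mu t ih => simp only [rename, subst, ih, up_upRen]
  | pair t e iht ihe => simp only [rename, subst, iht, ihe]
  | cut t e iht ihe => simp only [rename, subst, iht, ihe]

theorem rename_up (ρ : ℕ → ℕ) (σ : ℕ → SymTm) :
    (fun n => rename (upRen ρ) (up σ n)) = up fun n => rename ρ (σ n) := by
  funext n; cases n with
  | zero => rfl
  | succ n => exact rename_shift ρ (σ n)

theorem rename_subst (ρ : ℕ → ℕ) (σ : ℕ → SymTm) (u : SymTm) :
    rename ρ (subst σ u) = subst (fun n => rename ρ (σ n)) u := by
  induction u generalizing σ ρ with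
  | var n => rfl
  | lam t ih => simp only [rename, subst, ih, rename_up]
  | mu t ih => simp only [rename, subst, ih, rename_up]
  | pair t e iht ihe => simp only [rename, subst, iht, ihe]
  | cut t e iht ihe => simp only [rename, subst, iht, ihe]

theorem subst_shift (σ : ℕ → SymTm) (u : SymTm) : subst (up σ) (shift u) = shift (subst σ u) := by
  simp only [shift, subst_rename, rename_subst]; rfl

theorem subst_up (σ τ : ℕ → SymTm) :
    (fun n => subst (up σ) (up τ n)) = up fun n => subst σ (τ n) := by
  funext n; cases n with
  | zero => rfl
  | succ n => exact subst_shift σ (τ n)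

theorem subst_subst (σ τ : ℕ → SymTm) (u : SymTm) :
    subst σ (subst τ u) = subst (fun n => subst σ (τ n)) u := by
  induction u generalizing σ τ with
  | var n => rfl
  | lam t ih => simp only [subst, ih, subst_up]
  | mu t ih => simp only [subst, ih, subst_up]
  | pair t e iht ihe => simp only [subst, iht, ihe]
  | cut t e iht ihe => simp only [subst, iht, ihe]

theorem up_var : up var = var := by
  funext n; cases n <;> rfl

theorem subst_var (u : SymTm) : subst var u = u := by
  induction u with
  | var n => rfl
  | lam t ih => simp only [subst, up_var, ih]
  | mu t ih => simp only [subst, up_var, ih]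
  | pair t e iht ihe => simp only [subst, iht, ihe]
  | cut t e iht ihe => simp only [subst, iht, ihe]

theorem rename_eq_subst (ρ : ℕ → ℕ) (u : SymTm) : rename ρ u = subst (fun n => var (ρ n)) u := by
  conv_lhs => rw [← subst_var u, rename_subst]
  rfl

theorem inst_shift (u v : SymTm) : inst (shift u) v = u := by
  simp only [inst, shift, subst_rename]
  exact subst_var u

theorem subst_inst (σ : ℕ → SymTm) (p v : SymTm) :
    subst σ (inst p v) = inst (subst (up σ) p) (subst σ v) := by
  simp only [inst, subst_subst]
  congr 1
  funext n; cases n with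
  | zero => rfl
  | succ n => exact (inst_shift (σ n) (subst σ v)).symm

/-- One-step reduction; every rule on cuts comes in both orientations. -/
inductive Step : SymTm → SymTm → Prop
  | lam_pair (t t' e : SymTm) : Step (cut (lam t) (pair t' e)) (cut t' (mu (cut t (shift e))))
  | pair_lam (t t' e : SymTm) : Step (cut (pair t' e) (lam t)) (cut t' (mu (cut t (shift e))))
  | mu_left (p v : SymTm) : Step (cut (mu p) v) (inst p v)
  | mu_right (p v : SymTm) : Step (cut v (mu p)) (inst p v)
  | eta_left (t : SymTm) : Step (mu (cut (shift t) (var 0))) t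
  | eta_right (t : SymTm) : Step (mu (cut (var 0) (shift t))) t
  | lam {t t' : SymTm} (h : Step t t') : Step (lam t) (lam t')
  | mu {t t' : SymTm} (h : Step t t') : Step (mu t) (mu t')
  | pair_left {t t' : SymTm} (e : SymTm) (h : Step t t') : Step (pair t e) (pair t' e)
  | pair_right (t : SymTm) {e e' : SymTm} (h : Step e e') : Step (pair t e) (pair t e')
  | cut_left {t t' : SymTm} (e : SymTm) (h : Step t t') : Step (cut t e) (cut t' e)
  | cut_right (t : SymTm) {e e' : SymTm} (h : Step e e') : Step (cut t e) (cut t e')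

theorem Step.subst {u v : SymTm} (h : Step u v) (σ : ℕ → SymTm) :
    Step (u.subst σ) (v.subst σ) := by
  induction h generalizing σ with
  | lam_pair t t' e =>
    simp only [SymTm.subst, subst_shift]; exact .lam_pair _ _ _
  | pair_lam t t' e =>
    simp only [SymTm.subst, subst_shift]; exact .pair_lam _ _ _
  | mu_left p v => rw [subst_inst]; exact .mu_left _ _
  | mu_right p v => rw [subst_inst]; exact .mu_right _ _
  | eta_left t => simp only [SymTm.subst, subst_shift]; exact .eta_left _
  | eta_right t => simp only [SymTm.subst, subst_shift]; exact .eta_right _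
  | lam h ih => exact .lam (ih _)
  | mu h ih => exact .mu (ih _)
  | pair_left e h ih => exact .pair_left _ (ih _)
  | pair_right t h ih => exact .pair_right _ (ih _)
  | cut_left e h ih => exact .cut_left _ (ih _)
  | cut_right t h ih => exact .cut_right _ (ih _)

theorem Step.shift {u v : SymTm} (h : Step u v) : Step u.shift v.shift := by
  simpa only [SymTm.shift, rename_eq_subst] using h.subst _

/-! ### Exchanging the two sides of cuts -/

/-- Equality up to exchanging the two sides of cuts. -/
inductive Swap : SymTm → SymTm → Prop
  | var (n : ℕ) : Swap (var n) (var n)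
  | lam {t t' : SymTm} (h : Swap t t') : Swap (lam t) (lam t')
  | mu {t t' : SymTm} (h : Swap t t') : Swap (mu t) (mu t')
  | pair {t t' e e' : SymTm} (ht : Swap t t') (he : Swap e e') : Swap (pair t e) (pair t' e')
  | cut {t t' e e' : SymTm} (ht : Swap t t') (he : Swap e e') : Swap (cut t e) (cut t' e')
  | exch {t t' e e' : SymTm} (ht : Swap t t') (he : Swap e e') : Swap (cut t e) (cut e' t')

namespace Swap

theorem refl (u : SymTm) : Swap u u := by
  induction u with
  | var n => exact .var n
  | lam t ih => exact .lam ih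
  | mu t ih => exact .mu ih
  | pair t e iht ihe => exact .pair iht ihe
  | cut t e iht ihe => exact .cut iht ihe

theorem symm {u v : SymTm} (h : Swap u v) : Swap v u := by
  induction h with
  | var n => exact .var n
  | lam _ ih => exact .lam ih
  | mu _ ih => exact .mu ih
  | pair _ _ iht ihe => exact .pair iht ihe
  | cut _ _ iht ihe => exact .cut iht ihe
  | exch _ _ iht ihe => exact .exch ihe iht

theorem trans {u v w : SymTm} (h : Swap u v) (h' : Swap v w) : Swap u w := by
  induction h generalizing w with
  | var n => exact h'
  | lam _ ih => cases h' with | lam h => exact .lam (ih h)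
  | mu _ ih => cases h' with | mu h => exact .mu (ih h)
  | pair _ _ iht ihe => cases h' with | pair a b => exact .pair (iht a) (ihe b)
  | cut _ _ iht ihe =>
    cases h' with
    | cut a b => exact .cut (iht a) (ihe b)
    | exch a b => exact .exch (iht a) (ihe b)
  | exch _ _ iht ihe =>
    cases h' with
    | cut a b => exact .exch (iht b) (ihe a)
    | exch a b => exact .cut (iht b) (ihe a)

theorem rename {u v : SymTm} (h : Swap u v) (ρ : ℕ → ℕ) : Swap (u.rename ρ) (v.rename ρ) := by
  induction h generalizing ρ with
  | var n => exact .var _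
  | lam _ ih => exact .lam (ih _)
  | mu _ ih => exact .mu (ih _)
  | pair _ _ iht ihe => exact .pair (iht _) (ihe _)
  | cut _ _ iht ihe => exact .cut (iht _) (ihe _)
  | exch _ _ iht ihe => exact .exch (iht _) (ihe _)

theorem subst {u v : SymTm} (h : Swap u v) {σ τ : ℕ → SymTm} (hσ : ∀ n, Swap (σ n) (τ n)) :
    Swap (u.subst σ) (v.subst τ) := by
  have hup : ∀ {σ τ : ℕ → SymTm}, (∀ n, Swap (σ n) (τ n)) → ∀ n, Swap (up σ n) (up τ n) := by
    intro σ τ h n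
    cases n with
    | zero => exact .var 0
    | succ n => exact (h n).rename _
  induction h generalizing σ τ with
  | var n => exact hσ n
  | lam _ ih => exact .lam (ih (hup hσ))
  | mu _ ih => exact .mu (ih (hup hσ))
  | pair _ _ iht ihe => exact .pair (iht hσ) (ihe hσ)
  | cut _ _ iht ihe => exact .cut (iht hσ) (ihe hσ)
  | exch _ _ iht ihe => exact .exch (iht hσ) (ihe hσ)

theorem inst {p p' v v' : SymTm} (hp : Swap p p') (hv : Swap v v') :
    Swap (p.inst v) (p'.inst v') := by
  refine hp.subst fun n => ?_
  cases n with
  | zero => exact hv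
  | succ n => exact .var n

theorem exists_of_rename {ρ : ℕ → ℕ} {u v : SymTm} (h : Swap (u.rename ρ) v) :
    ∃ w, v = w.rename ρ ∧ Swap u w := by
  induction u generalizing ρ v with
  | var n => cases h with | var => exact ⟨.var n, rfl, .var n⟩
  | lam t ih =>
    cases h with
    | lam h => obtain ⟨w, rfl, hw⟩ := ih h; exact ⟨.lam w, rfl, .lam hw⟩
  | mu t ih =>
    cases h with
    | mu h => obtain ⟨w, rfl, hw⟩ := ih h; exact ⟨.mu w, rfl, .mu hw⟩
  | pair t e iht ihe =>
    cases h with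
    | pair a b =>
      obtain ⟨w, rfl, hw⟩ := iht a
      obtain ⟨z, rfl, hz⟩ := ihe b
      exact ⟨.pair w z, rfl, .pair hw hz⟩
  | cut t e iht ihe =>
    cases h with
    | cut a b =>
      obtain ⟨w, rfl, hw⟩ := iht a
      obtain ⟨z, rfl, hz⟩ := ihe b
      exact ⟨.cut w z, rfl, .cut hw hz⟩
    | exch a b =>
      obtain ⟨w, rfl, hw⟩ := iht a
      obtain ⟨z, rfl, hz⟩ := ihe b
      exact ⟨.cut z w, rfl, .exch hw hz⟩

theorem exists_step {u u' v : SymTm} (hs : Step u u') (h : Swap u v) :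
    ∃ v', Step v v' ∧ Swap u' v' := by
  induction hs generalizing v with
  | lam_pair t t' e =>
    cases h with
    | cut a b =>
      cases a with | lam a => cases b with | pair b c =>
      exact ⟨_, .lam_pair _ _ _, .cut b (.mu (.cut a (c.rename _)))⟩
    | exch a b =>
      cases a with | lam a => cases b with | pair b c =>
      exact ⟨_, .pair_lam _ _ _, .cut b (.mu (.cut a (c.rename _)))⟩
  | pair_lam t t' e =>
    cases h with
    | cut b a =>
      cases a with | lam a => cases b with | pair b c =>
      exact ⟨_, .pair_lam _ _ _, .cut b (.mu (.cut a (c.rename _)))⟩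
    | exch b a =>
      cases a with | lam a => cases b with | pair b c =>
      exact ⟨_, .lam_pair _ _ _, .cut b (.mu (.cut a (c.rename _)))⟩
  | mu_left p v =>
    cases h with
    | cut a b => cases a with | mu a => exact ⟨_, .mu_left _ _, a.inst b⟩
    | exch a b => cases a with | mu a => exact ⟨_, .mu_right _ _, a.inst b⟩
  | mu_right p v =>
    cases h with
    | cut b a => cases a with | mu a => exact ⟨_, .mu_right _ _, a.inst b⟩
    | exch b a => cases a with | mu a => exact ⟨_, .mu_left _ _, a.inst b⟩
  | eta_left t =>
    cases h with | mu h =>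
    cases h with
    | cut a b =>
      cases b; obtain ⟨w, rfl, hw⟩ := exists_of_rename a
      exact ⟨w, .eta_left _, hw⟩
    | exch a b =>
      cases b; obtain ⟨w, rfl, hw⟩ := exists_of_rename a
      exact ⟨w, .eta_right _, hw⟩
  | eta_right t =>
    cases h with | mu h =>
    cases h with
    | cut b a =>
      cases b; obtain ⟨w, rfl, hw⟩ := exists_of_rename a
      exact ⟨w, .eta_right _, hw⟩
    | exch b a =>
      cases b; obtain ⟨w, rfl, hw⟩ := exists_of_rename a
      exact ⟨w, .eta_left _, hw⟩
  | lam _ ih =>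
    cases h with | lam h =>
    obtain ⟨w, hs, hw⟩ := ih h
    exact ⟨_, .lam hs, .lam hw⟩
  | mu _ ih =>
    cases h with | mu h =>
    obtain ⟨w, hs, hw⟩ := ih h
    exact ⟨_, .mu hs, .mu hw⟩
  | pair_left e _ ih =>
    cases h with | pair a b =>
    obtain ⟨w, hs, hw⟩ := ih a
    exact ⟨_, .pair_left _ hs, .pair hw b⟩
  | pair_right t _ ih =>
    cases h with | pair a b =>
    obtain ⟨w, hs, hw⟩ := ih b
    exact ⟨_, .pair_right _ hs, .pair a hw⟩
  | cut_left e _ ih =>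
    cases h with
    | cut a b => obtain ⟨w, hs, hw⟩ := ih a; exact ⟨_, .cut_left _ hs, .cut hw b⟩
    | exch a b => obtain ⟨w, hs, hw⟩ := ih a; exact ⟨_, .cut_right _ hs, .exch hw b⟩
  | cut_right t _ ih =>
    cases h with
    | cut a b => obtain ⟨w, hs, hw⟩ := ih b; exact ⟨_, .cut_right _ hs, .cut a hw⟩
    | exch a b => obtain ⟨w, hs, hw⟩ := ih b; exact ⟨_, .cut_left _ hs, .exch a hw⟩

end Swap

/-! ### Strongly normalizing terms -/

/-- Every reduction sequence starting from `u` is finite. -/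
def SN (u : SymTm) : Prop := Acc (fun v u => Step u v) u

namespace SN

theorem step {u v : SymTm} (h : SN u) (hs : Step u v) : SN v := h.inv hs

theorem of_swap {u v : SymTm} (h : SN u) (hw : Swap u v) : SN v := by
  induction h generalizing v with
  | intro u _ ih =>
    refine ⟨_, fun v' hs => ?_⟩
    obtain ⟨u', hs', hw'⟩ := Swap.exists_step hs hw.symm
    exact ih u' hs' hw'.symm

theorem cut_comm {u v : SymTm} (h : SN (cut u v)) : SN (cut v u) :=
  h.of_swap (.exch (.refl u) (.refl v))

/-- Strong normalizability is reflected by any map that preserves steps. -/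
theorem of_map (f : SymTm → SymTm) (hf : ∀ {u v}, Step u v → Step (f u) (f v)) {u : SymTm}
    (h : SN (f u)) : SN u := by
  generalize hw : f u = w at h
  induction h generalizing u with
  | intro w _ ih => subst hw; exact ⟨_, fun v hs => ih _ (hf hs) rfl⟩

theorem of_inst {p v : SymTm} (h : SN (p.inst v)) : SN p := of_map (·.inst v) (·.subst _) h

theorem cut_of_inst_left {t v : SymTm} (h : SN ((cut t.shift (var 0)).inst v)) : SN (cut t v) := by
  change SN (cut (t.shift.inst v) v) at h
  rwa [inst_shift] at h

theorem cut_of_inst_right {t v : SymTm} (h : SN ((cut (var 0) t.shift).inst v)) : SN (cut t v) := by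
  change SN (cut v (t.shift.inst v)) at h
  rw [inst_shift] at h
  exact h.cut_comm

theorem var (n : ℕ) : SN (var n) := ⟨_, fun _ h => nomatch h⟩

theorem lam {t : SymTm} (h : SN t) : SN (lam t) := by
  induction h with
  | intro t _ ih => exact ⟨_, fun _ hs => by cases hs with | lam hs => exact ih _ hs⟩

theorem pair {t e : SymTm} (ht : SN t) (he : SN e) : SN (pair t e) := by
  induction ht generalizing e with
  | intro t ht iht =>
    induction he with
    | intro e he ihe =>
      refine ⟨_, fun _ hs => ?_⟩
      cases hs with
      | pair_left _ hs => exact iht _ hs ⟨_, he⟩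
      | pair_right _ hs => exact ihe _ hs

theorem mu {p : SymTm} (h : SN p) : SN (mu p) := by
  induction h with
  | intro p hp ih =>
    refine ⟨_, fun _ hs => ?_⟩
    cases hs with
    | mu hs => exact ih _ hs
    | eta_left t =>
      exact of_map (fun u => SymTm.cut u.shift (.var 0)) (fun h => .cut_left _ h.shift) ⟨_, hp⟩
    | eta_right t =>
      exact of_map (fun u => SymTm.cut (.var 0) u.shift) (fun h => .cut_right _ h.shift) ⟨_, hp⟩

theorem cut_lam_pair {s t e : SymTm} (h : SN (cut t (.mu (cut s e.shift)))) :
    SN (cut (.lam s) (.pair t e)) := by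
  generalize hw : cut t (.mu (cut s e.shift)) = w at h
  induction h generalizing s t e with
  | intro w hacc ih =>
    subst hw
    refine ⟨_, fun _ hs => ?_⟩
    cases hs with
    | lam_pair => exact ⟨_, hacc⟩
    | cut_left _ hs =>
      cases hs with
      | lam hs => exact ih _ (.cut_right _ (.mu (.cut_left _ hs))) rfl
    | cut_right _ hs =>
      cases hs with
      | pair_left _ hs => exact ih _ (.cut_left _ hs) rfl
      | pair_right _ hs => exact ih _ (.cut_right _ (.mu (.cut_right _ hs.shift))) rfl

end SN

/-! ### Symmetric reducibility candidates -/

/-- Values: abstractions and pairs. -/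
inductive IsValue : SymTm → Prop
  | lam (t : SymTm) : IsValue (lam t)
  | pair (t e : SymTm) : IsValue (pair t e)

theorem IsValue.step {u v : SymTm} (h : IsValue u) (hs : Step u v) : IsValue v := by
  cases h <;> cases hs <;> constructor

/-- The strongly normalizing values whose cuts against `S` are strongly normalizing. -/
def orth (S : Set SymTm) : Set SymTm := {v | IsValue v ∧ SN v ∧ ∀ w ∈ S, SN (cut v w)}

theorem orth_step {S : Set SymTm} {u v : SymTm} (h : u ∈ orth S) (hs : Step u v) : v ∈ orth S :=
  ⟨h.1.step hs, h.2.1.step hs, fun w hw => (h.2.2 w hw).step (.cut_left _ hs)⟩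

theorem orth_anti {S T : Set SymTm} (h : S ⊆ T) : orth T ⊆ orth S :=
  fun _ hv => ⟨hv.1, hv.2.1, fun w hw => hv.2.2 w (h hw)⟩

theorem mem_orth_orth {S : Set SymTm} {v : SymTm} (hv : v ∈ S) (hval : IsValue v) (hsn : SN v) :
    v ∈ orth (orth S) :=
  ⟨hval, hsn, fun _ hw => (hw.2.2 v hv).cut_comm⟩

theorem orth_orth_orth {S : Set SymTm} (hS : ∀ v ∈ S, IsValue v ∧ SN v) :
    orth (orth (orth S)) = orth S :=
  Set.Subset.antisymm (orth_anti fun v hv => mem_orth_orth hv (hS v hv).1 (hS v hv).2)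
    fun _ hv => mem_orth_orth hv hv.1 hv.2.1

/-- The strongly normalizing terms all of whose reducts are harmless: a value must lie in `V`,
a `μ`-abstraction must be strongly normalizing when applied to elements of `Y`. -/
def closure (V Y : Set SymTm) : Set SymTm :=
  {u | SN u ∧ ∀ u', Relation.ReflTransGen Step u u' →
    (∀ p, u' = mu p → ∀ v ∈ Y, SN (p.inst v)) ∧ (IsValue u' → u' ∈ V)}

theorem closure_anti (V : Set SymTm) {Y Z : Set SymTm} (h : Y ⊆ Z) : closure V Z ⊆ closure V Y :=
  fun _ hu => ⟨hu.1, fun u' hs => ⟨fun p hp v hv => (hu.2 u' hs).1 p hp v (h hv), (hu.2 u' hs).2⟩⟩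

theorem closure_step {V Y : Set SymTm} {u v : SymTm} (h : u ∈ closure V Y) (hs : Step u v) :
    v ∈ closure V Y :=
  ⟨h.1.step hs, fun u' hs' => h.2 u' (.head hs hs')⟩

theorem var_mem_closure (V Y : Set SymTm) (n : ℕ) : var n ∈ closure V Y := by
  refine ⟨.var n, fun u' hs => ?_⟩
  obtain rfl | ⟨_, hs, _⟩ := hs.cases_head
  · exact ⟨fun _ hp => (nomatch hp), fun h => (nomatch h)⟩
  · exact nomatch hs

theorem orth_subset_closure (S Y : Set SymTm) : orth S ⊆ closure (orth S) Y := by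
  refine fun u hu => ⟨hu.2.1, fun u' hs => ?_⟩
  have hu' : u' ∈ orth S := by
    induction hs with
    | refl => exact hu
    | tail _ hs ih => exact orth_step ih hs
  exact ⟨fun p hp => by subst hp; exact (nomatch hu'.1), fun _ => hu'⟩

/-- A symmetric pair of candidates, `V` and `W` being their respective sets of values. -/
structure IsCand (V W L R : Set SymTm) : Prop where
  left_values : V = orth W
  right_values : W = orth V
  left : L = closure V R
  right : R = closure W L

namespace IsCand

variable {V W L R : Set SymTm}

theorem symm (h : IsCand V W L R) : IsCand W V R L := ⟨h.2, h.1, h.4, h.3⟩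

theorem sn (h : IsCand V W L R) {u : SymTm} (hu : u ∈ L) : SN u := by
  rw [h.left] at hu; exact hu.1

theorem step (h : IsCand V W L R) {u v : SymTm} (hu : u ∈ L) (hs : Step u v) : v ∈ L := by
  rw [h.left] at hu ⊢; exact closure_step hu hs

theorem var_mem (h : IsCand V W L R) (n : ℕ) : var n ∈ L := by
  rw [h.left]; exact var_mem_closure V R n

theorem values_subset (h : IsCand V W L R) : V ⊆ L := by
  rw [h.left, h.left_values]; exact orth_subset_closure W R

theorem mem_values (h : IsCand V W L R) {u : SymTm} (hu : u ∈ L) (hval : IsValue u) : u ∈ V := by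
  rw [h.left] at hu; exact (hu.2 u .refl).2 hval

theorem sn_inst (h : IsCand V W L R) {p v : SymTm} (hp : mu p ∈ L) (hv : v ∈ R) :
    SN (p.inst v) := by
  rw [h.left] at hp; exact (hp.2 _ .refl).1 p rfl v hv

theorem sn_cut (h : IsCand V W L R) {u v : SymTm} (hu : u ∈ L) (hv : v ∈ R) : SN (cut u v) := by
  have hsu := h.sn hu
  induction hsu generalizing v with
  | intro u hau ihu =>
    have hsv := h.symm.sn hv
    induction hsv with
    | intro v hav ihv =>
      have hval : IsValue u → IsValue v → SN (cut u v) := fun hu' hv' =>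
        ((h.left_values ▸ h.mem_values hu hu' : u ∈ orth W)).2.2 v (h.symm.mem_values hv hv')
      refine ⟨_, fun w hs => ?_⟩
      cases hs with
      | lam_pair => exact (hval (.lam _) (.pair _ _)).step (.lam_pair _ _ _)
      | pair_lam => exact (hval (.pair _ _) (.lam _)).step (.pair_lam _ _ _)
      | mu_left => exact h.sn_inst hu hv
      | mu_right => exact h.symm.sn_inst hv hu
      | cut_left _ hs => exact ihu _ hs (h.step hu hs) hv
      | cut_right _ hs => exact ihv _ hs (h.symm.step hv hs)

theorem mu_mem (h : IsCand V W L R) {p : SymTm} (hp : ∀ v ∈ R, SN (p.inst v)) : mu p ∈ L := by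
  have hsn : SN (mu p) := (hp _ (h.symm.var_mem 0)).of_inst.mu
  rw [h.left]
  refine ⟨hsn, fun u' hs => ?_⟩
  have key : SN u' ∧ ((∃ q, u' = mu q ∧ ∀ v ∈ R, SN (q.inst v)) ∨ ∀ v ∈ R, SN (cut u' v)) := by
    induction hs with
    | refl => exact ⟨hsn, .inl ⟨p, rfl, hp⟩⟩
    | tail _ hs ih =>
      obtain ⟨hsn', ⟨q, rfl, hq⟩ | hcut⟩ := ih
      · refine ⟨hsn'.step hs, ?_⟩
        cases hs with
        | mu hs => exact .inl ⟨_, rfl, fun v hv => (hq v hv).step (hs.subst _)⟩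
        | eta_left => exact .inr fun v hv => SN.cut_of_inst_left (hq v hv)
        | eta_right => exact .inr fun v hv => SN.cut_of_inst_right (hq v hv)
      · exact ⟨hsn'.step hs, .inr fun v hv => (hcut v hv).step (.cut_left _ hs)⟩
  obtain ⟨hsn', ⟨q, rfl, hq⟩ | hcut⟩ := key
  · exact ⟨fun p hp => by cases hp; exact hq, fun hval => nomatch hval⟩
  · refine ⟨fun p hp v hv => ?_, fun hval => ?_⟩
    · subst hp; exact (hcut v hv).step (.mu_left _ _)
    · rw [h.left_values]
      exact ⟨hval, hsn', fun w hw => hcut w (h.symm.values_subset hw)⟩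

end IsCand

/-- The monotone operator whose least fixed point is the left half of a symmetric pair. -/
def closureHom (V W : Set SymTm) : Set SymTm →o Set SymTm where
  toFun X := closure V (closure W X)
  monotone' _ _ h := closure_anti V (closure_anti W h)

/-- The symmetric pair of candidates generated by a set `P` of right values. -/
def cand (P : Set SymTm) : Set SymTm × Set SymTm :=
  let L := (closureHom (orth P) (orth (orth P))).lfp
  (L, closure (orth (orth P)) L)

theorem isCand_cand {P : Set SymTm} (hP : ∀ v ∈ P, IsValue v ∧ SN v) :
    IsCand (orth P) (orth (orth P)) (cand P).1 (cand P).2 :=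
  ⟨(orth_orth_orth hP).symm, rfl, (closureHom (orth P) (orth (orth P))).map_lfp.symm, rfl⟩

end SymTm

/-! ### Interpretation of types -/

open SymTm

/-- The pairs with components in `S` and `T`. -/
def pairs (S T : Set SymTm) : Set SymTm := {v | ∃ t ∈ S, ∃ e ∈ T, v = .pair t e}

/-- The interpretation of a type expression: its `l`-terms and its `r`-terms. -/
def PreTy.interp {𝒜 : Type u} : {s : Calculus} → PreTy 𝒜 s → Set SymTm × Set SymTm
  | _, .atom _ => cand ∅
  | _, .arr A B => cand (pairs A.interp.1 B.interp.2)
  | _, .neg A => A.interp.swap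

theorem PreTy.interp_eq {𝒜 : Type u} {s : Calculus} {A B : PreTy 𝒜 s} (h : PreTy.Rel A B) :
    A.interp = B.interp := by
  induction h with
  | neg_neg A => rfl
  | neg _ ih => simp only [PreTy.interp, ih]
  | arr_left B _ ih => simp only [PreTy.interp, ih]
  | arr_right A _ ih => simp only [PreTy.interp, ih]

namespace Ty

variable {𝒜 : Type u} {s : Calculus}

/-- The interpretation of a type: its `l`-terms and its `r`-terms. -/
def interp : Ty 𝒜 s → Set SymTm × Set SymTm := Quot.lift PreTy.interp fun _ _ => PreTy.interp_eq

theorem interp_arr (A B : Ty 𝒜 s) :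
    (arr A B).interp = cand (pairs A.interp.1 B.interp.2) := by
  induction A using Quot.ind
  induction B using Quot.ind
  rfl

theorem interp_neg (A : Ty 𝒜 .star) : (neg A).interp = A.interp.swap := by
  induction A using Quot.ind
  rfl

end Ty

theorem pairs_sn {V W L R V' W' L' R' : Set SymTm} (h : IsCand V W L R) (h' : IsCand V' W' L' R') :
    ∀ v ∈ pairs L R', IsValue v ∧ SN v := by
  rintro _ ⟨t, ht, e, he, rfl⟩
  exact ⟨.pair t e, (h.sn ht).pair (h'.symm.sn he)⟩

theorem Ty.exists_isCand {𝒜 : Type u} {s : Calculus} (A : Ty 𝒜 s) :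
    ∃ V W, IsCand V W A.interp.1 A.interp.2 := by
  induction A using Quot.ind with
  | _ A =>
    change ∃ V W, IsCand V W A.interp.1 A.interp.2
    induction A with
    | atom a => exact ⟨_, _, isCand_cand fun v hv => hv.elim⟩
    | arr A B ihA ihB =>
      obtain ⟨_, _, hA⟩ := ihA
      obtain ⟨_, _, hB⟩ := ihB
      exact ⟨_, _, isCand_cand (pairs_sn hA hB)⟩
    | neg A ih =>
      obtain ⟨V, W, h⟩ := ih
      exact ⟨W, V, h.symm⟩

/-! ### Translation -/

/-- The translation that erases both negations, with `σ` and `τ` substituted for the `l`-variables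
and the `r`-variables. -/
def Tm.toSym : {s : Calculus} → {k : Kind} → (σ τ : ℕ → SymTm) → Tm s k → SymTm
  | _, _, σ, τ, .cut t e => .cut (toSym σ τ t) (toSym σ τ e)
  | _, _, σ, _, .lvar x => σ x
  | _, _, σ, τ, .lam t => .lam (toSym (up σ) (fun n => (τ n).shift) t)
  | _, _, σ, τ, .mu p => .mu (toSym (fun n => (σ n).shift) (up τ) p)
  | _, _, σ, τ, .bar e => toSym σ τ e
  | _, _, _, τ, .rvar a => τ a
  | _, _, σ, τ, .app t e => .pair (toSym σ τ t) (toSym σ τ e)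
  | _, _, σ, τ, .mutilde p => .mu (toSym (up σ) (fun n => (τ n).shift) p)
  | _, _, σ, τ, .tilde t => toSym σ τ t

namespace Tm

variable {s : Calculus} {k : Kind}

theorem subst_toSym (ξ σ τ : ℕ → SymTm) (u : Tm s k) :
    (toSym σ τ u).subst ξ =
      toSym (fun n => (σ n).subst ξ) (fun n => (τ n).subst ξ) u := by
  induction u generalizing ξ σ τ with
  | cut t e iht ihe => simp only [toSym, SymTm.subst, iht, ihe]
  | lvar x => rfl
  | lam t ih => simp only [toSym, SymTm.subst, ih, subst_up, subst_shift]
  | mu p ih => simp only [toSym, SymTm.subst, ih, subst_up, subst_shift]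
  | bar e ih => simp only [toSym, ih]
  | rvar a => rfl
  | app t e iht ihe => simp only [toSym, SymTm.subst, iht, ihe]
  | mutilde p ih => simp only [toSym, SymTm.subst, ih, subst_up, subst_shift]
  | tilde t ih => simp only [toSym, ih]

theorem toSym_shift (σ τ : ℕ → SymTm) (u : Tm s k) :
    toSym (fun n => (σ n).shift) (fun n => (τ n).shift) u = (toSym σ τ u).shift := by
  simp only [SymTm.shift, rename_eq_subst, subst_toSym]

theorem toSym_rename (σ τ : ℕ → SymTm) (ρ θ : ℕ → ℕ) (u : Tm s k) :
    toSym σ τ (rename ρ θ u) = toSym (fun n => σ (ρ n)) (fun n => τ (θ n)) u := by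
  induction u generalizing σ τ ρ θ with
  | cut t e iht ihe => simp only [toSym, rename, iht, ihe]
  | lvar x => rfl
  | lam t ih => simp only [toSym, rename, ih, up_upRen]
  | mu p ih => simp only [toSym, rename, ih, up_upRen]
  | bar e ih => simp only [toSym, rename, ih]
  | rvar a => rfl
  | app t e iht ihe => simp only [toSym, rename, iht, ihe]
  | mutilde p ih => simp only [toSym, rename, ih, up_upRen]
  | tilde t ih => simp only [toSym, rename, ih]

theorem toSym_up_shiftL (σ τ : ℕ → SymTm) (u : Tm s k) :
    toSym (up σ) (fun n => (τ n).shift) (shiftL u) = (toSym σ τ u).shift := by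
  rw [shiftL, toSym_rename, ← toSym_shift]; rfl

theorem toSym_up_shiftR (σ τ : ℕ → SymTm) (u : Tm s k) :
    toSym (fun n => (σ n).shift) (up τ) (shiftR u) = (toSym σ τ u).shift := by
  rw [shiftR, toSym_rename, ← toSym_shift]; rfl

theorem toSym_scons (σ τ : ℕ → SymTm) (u : Tm s k) (f : ℕ → Tm s k) :
    (fun n => toSym σ τ (scons u f n)) = SymTm.scons (toSym σ τ u) fun n => toSym σ τ (f n) := by
  funext n; cases n <;> rfl

theorem toSym_subst (σ τ : ℕ → SymTm) (σ' : ℕ → Tm s .l) (τ' : ℕ → Tm s .r) (u : Tm s k) :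
    toSym σ τ (subst σ' τ' u) =
      toSym (fun n => toSym σ τ (σ' n)) (fun n => toSym σ τ (τ' n)) u := by
  induction u generalizing σ τ with
  | cut t e iht ihe => simp only [toSym, subst, iht, ihe]
  | lvar x => rfl
  | lam t ih => simp only [toSym, subst, ih, toSym_scons, toSym_up_shiftL]; rfl
  | mu p ih => simp only [toSym, subst, ih, toSym_scons, toSym_up_shiftR]; rfl
  | bar e ih => simp only [toSym, subst, ih]
  | rvar a => rfl
  | app t e iht ihe => simp only [toSym, subst, iht, ihe]
  | mutilde p ih => simp only [toSym, subst, ih, toSym_scons, toSym_up_shiftL]; rfl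
  | tilde t ih => simp only [toSym, subst, ih]

theorem inst_toSym_up_left (σ τ : ℕ → SymTm) (u : Tm s k) (v : SymTm) :
    (toSym (up σ) (fun n => (τ n).shift) u).inst v = toSym (SymTm.scons v σ) τ u := by
  have hτ : (fun n => (τ n).shift.subst (SymTm.scons v .var)) = τ :=
    funext fun n => inst_shift (τ n) v
  have hσ : (fun n => (up σ n).subst (SymTm.scons v .var)) = SymTm.scons v σ := by
    funext n; cases n with
    | zero => rfl
    | succ n => exact inst_shift (σ n) v
  rw [inst, subst_toSym, hσ, hτ]

theorem inst_toSym_up_right (σ τ : ℕ → SymTm) (u : Tm s k) (v : SymTm) :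
    (toSym (fun n => (σ n).shift) (up τ) u).inst v = toSym σ (SymTm.scons v τ) u := by
  have hσ : (fun n => (σ n).shift.subst (SymTm.scons v .var)) = σ :=
    funext fun n => inst_shift (σ n) v
  have hτ : (fun n => (up τ n).subst (SymTm.scons v .var)) = SymTm.scons v τ := by
    funext n; cases n with
    | zero => rfl
    | succ n => exact inst_shift (τ n) v
  rw [inst, subst_toSym, hσ, hτ]

theorem toSym_instL (σ τ : ℕ → SymTm) (u : Tm s k) (t : Tm s .l) :
    toSym σ τ (instL u t) = (toSym (up σ) (fun n => (τ n).shift) u).inst (toSym σ τ t) := by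
  rw [inst_toSym_up_left, instL, toSym_subst, toSym_scons]; rfl

theorem toSym_instR (σ τ : ℕ → SymTm) (u : Tm s k) (e : Tm s .r) :
    toSym σ τ (instR u e) = (toSym (fun n => (σ n).shift) (up τ) u).inst (toSym σ τ e) := by
  rw [inst_toSym_up_right, instR, toSym_subst, toSym_scons]; rfl

/-- The number of constructors of a term. -/
def size : {s : Calculus} → {k : Kind} → Tm s k → ℕ
  | _, _, .cut t e => size t + size e + 1
  | _, _, .lvar _ => 1
  | _, _, .lam t => size t + 1
  | _, _, .mu p => size p + 1
  | _, _, .bar e => size e + 1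
  | _, _, .rvar _ => 1
  | _, _, .app t e => size t + size e + 1
  | _, _, .mutilde p => size p + 1
  | _, _, .tilde t => size t + 1

end Tm

open Tm in
/-- A step is either simulated by the translation, or decreases the size and is invisible up to
exchanging the sides of cuts. -/
theorem Step.toSym {s : Calculus} {k : Kind} {u v : Tm s k} (h : Step u v) (σ τ : ℕ → SymTm) :
    SymTm.Step (u.toSym σ τ) (v.toSym σ τ) ∨
      Swap (u.toSym σ τ) (v.toSym σ τ) ∧ v.size < u.size := by
  induction h generalizing σ τ with
  | root h =>
    cases h with
    | lam t t' e =>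
      left; simp only [Tm.toSym, toSym_up_shiftL]; exact .lam_pair _ _ _
    | mu p e => left; rw [toSym_instR]; exact .mu_left _ _
    | mutilde t p => left; rw [toSym_instL]; exact .mu_right _ _
    | sl t => left; simp only [Tm.toSym, toSym_up_shiftR]; exact .eta_left _
    | sr e => left; simp only [Tm.toSym, toSym_up_shiftL]; exact .eta_right _
    | cl1l t => exact .inr ⟨.refl _, by simp only [size]; omega⟩
    | cl1r e => exact .inr ⟨.refl _, by simp only [size]; omega⟩
    | cl2 t e => exact .inr ⟨.exch (.refl _) (.refl _), by simp only [size]; omega⟩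
  | cut_left e _ ih =>
    exact (ih σ τ).imp (.cut_left _) fun h => ⟨.cut h.1 (.refl _), by simp only [size]; omega⟩
  | cut_right t _ ih =>
    exact (ih σ τ).imp (.cut_right _) fun h => ⟨.cut (.refl _) h.1, by simp only [size]; omega⟩
  | lam _ ih => exact (ih _ _).imp .lam fun h => ⟨.lam h.1, by simp only [size]; omega⟩
  | mu _ ih => exact (ih _ _).imp .mu fun h => ⟨.mu h.1, by simp only [size]; omega⟩
  | bar _ ih => exact (ih σ τ).imp id fun h => ⟨h.1, by simp only [size]; omega⟩
  | app_left e _ ih =>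
    exact (ih σ τ).imp (.pair_left _) fun h => ⟨.pair h.1 (.refl _), by simp only [size]; omega⟩
  | app_right t _ ih =>
    exact (ih σ τ).imp (.pair_right _) fun h => ⟨.pair (.refl _) h.1, by simp only [size]; omega⟩
  | mutilde _ ih => exact (ih _ _).imp .mu fun h => ⟨.mu h.1, by simp only [size]; omega⟩
  | tilde _ ih => exact (ih σ τ).imp id fun h => ⟨h.1, by simp only [size]; omega⟩

theorem acc_of_sn_toSym {s : Calculus} {k : Kind} {σ τ : ℕ → SymTm} {w : SymTm} (hw : SN w)
    (u : Tm s k) (hu : Swap (u.toSym σ τ) w) : Acc (fun v u : Tm s k => Step u v) u := by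
  induction hw generalizing u with
  | intro w _ ihw =>
    induction hn : u.size using Nat.strong_induction_on generalizing u with
    | _ n ihn =>
      refine ⟨_, fun v hs => ?_⟩
      obtain hs | ⟨hsw, hlt⟩ := hs.toSym σ τ
      · obtain ⟨w', hs', hw'⟩ := Swap.exists_step hs hu
        exact ihw w' hs' v hw'
      · exact ihn _ (hn ▸ hlt) v (hsw.symm.trans hu) rfl

theorem stronglyNormalizable_of_sn_toSym {s : Calculus} {k : Kind} {σ τ : ℕ → SymTm} {u : Tm s k}
    (h : SN (u.toSym σ τ)) : StronglyNormalizable u := by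
  rintro ⟨f, rfl, hf⟩
  have key : ∀ u, Acc (fun v u : Tm s k => Step u v) u → ∀ n, f n ≠ u := by
    intro u hu
    induction hu with
    | intro u _ ih =>
      rintro n rfl
      exact ih _ (hf n) (n + 1) rfl
  exact key _ (acc_of_sn_toSym h (f 0) (.refl _)) 0 rfl

/-! ### Adequacy -/

/-- The environment `σ` maps the variables of `Γ` into the sets assigned to their types by `I`. -/
def Realizes {X : Type u} (I : X → Set SymTm) (Γ : List X) (σ : ℕ → SymTm) : Prop :=
  ∀ n A, Γ[n]? = some A → σ n ∈ I A

theorem Realizes.cons {X : Type u} {I : X → Set SymTm} {Γ : List X} {σ : ℕ → SymTm}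
    (h : Realizes I Γ σ) {A : X} {v : SymTm} (hv : v ∈ I A) :
    Realizes I (A :: Γ) (SymTm.scons v σ) := by
  intro n B hB
  cases n with
  | zero => simp only [List.getElem?_cons_zero, Option.some.injEq] at hB; exact hB ▸ hv
  | succ n => exact h n B (by simpa using hB)

section Adequacy

variable {𝒜 : Type u} {s : Calculus}

/-- The `l`-terms of a type. -/
def Ty.lset (A : Ty 𝒜 s) : Set SymTm := A.interp.1

/-- The `r`-terms of a type. -/
def Ty.rset (A : Ty 𝒜 s) : Set SymTm := A.interp.2

theorem lam_mem_lset {A B : Ty 𝒜 s} {t : SymTm} (h : ∀ v ∈ A.lset, t.inst v ∈ B.lset) :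
    SymTm.lam t ∈ (A.arr B).lset := by
  obtain ⟨_, _, hA⟩ := A.exists_isCand
  obtain ⟨_, _, hB⟩ := B.exists_isCand
  rw [Ty.lset, Ty.interp_arr]
  refine (isCand_cand (pairs_sn hA hB)).values_subset ⟨.lam t, ?_, ?_⟩
  · exact (hB.sn (h _ (hA.var_mem 0))).of_inst.lam
  · rintro _ ⟨t', ht', e, he, rfl⟩
    refine SN.cut_lam_pair (hA.sn_cut ht' (hA.symm.mu_mem fun v hv => ?_))
    have hc := hB.sn_cut (h v hv) he
    rwa [← inst_shift e v] at hc

theorem pair_mem_rset {A B : Ty 𝒜 s} {t e : SymTm} (ht : t ∈ A.lset) (he : e ∈ B.rset) :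
    SymTm.pair t e ∈ (A.arr B).rset := by
  obtain ⟨_, _, hA⟩ := A.exists_isCand
  obtain ⟨_, _, hB⟩ := B.exists_isCand
  have hP := pairs_sn hA hB
  have hmem : SymTm.pair t e ∈ pairs A.interp.1 B.interp.2 := ⟨t, ht, e, he, rfl⟩
  rw [Ty.rset, Ty.interp_arr]
  exact (isCand_cand hP).symm.values_subset (mem_orth_orth hmem (hP _ hmem).1 (hP _ hmem).2)

theorem mu_mem_lset {A : Ty 𝒜 s} {p : SymTm} (h : ∀ v ∈ A.rset, SN (p.inst v)) :
    SymTm.mu p ∈ A.lset :=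
  let ⟨_, _, hA⟩ := A.exists_isCand
  hA.mu_mem h

theorem mu_mem_rset {A : Ty 𝒜 s} {p : SymTm} (h : ∀ v ∈ A.lset, SN (p.inst v)) :
    SymTm.mu p ∈ A.rset :=
  let ⟨_, _, hA⟩ := A.exists_isCand
  hA.symm.mu_mem h

theorem sn_cut_of_mem {A : Ty 𝒜 s} {t e : SymTm} (ht : t ∈ A.lset) (he : e ∈ A.rset) :
    SN (.cut t e) :=
  let ⟨_, _, hA⟩ := A.exists_isCand
  hA.sn_cut ht he

theorem realizes_lset_var (Γ : Ctx 𝒜 s) : Realizes Ty.lset Γ .var := fun n A _ =>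
  let ⟨_, _, hA⟩ := A.exists_isCand
  hA.var_mem n

theorem realizes_rset_var (Γ : Ctx 𝒜 s) : Realizes Ty.rset Γ .var := fun n A _ =>
  let ⟨_, _, hA⟩ := A.exists_isCand
  hA.symm.var_mem n

mutual

theorem TypedL.toSym_mem {s : Calculus} {Γ Δ : Ctx 𝒜 s} {t : Tm s .l} {A : Ty 𝒜 s} :
    TypedL Γ t A Δ → ∀ {σ τ : ℕ → SymTm}, Realizes Ty.lset Γ σ → Realizes Ty.rset Δ τ →
      t.toSym σ τ ∈ A.lset
  | .var h, _, _, hσ, _ => hσ _ _ h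
  | .lam h, _, _, hσ, hτ => lam_mem_lset fun v hv => by
      rw [Tm.inst_toSym_up_left]; exact h.toSym_mem (hσ.cons hv) hτ
  | .mu h, _, _, hσ, hτ => mu_mem_lset fun v hv => by
      rw [Tm.inst_toSym_up_right]; exact h.sn_toSym hσ (hτ.cons hv)
  | .bar h, _, _, hσ, hτ => by
      rw [Ty.lset, Ty.interp_neg]; exact h.toSym_mem hσ hτ

theorem TypedR.toSym_mem {s : Calculus} {Γ Δ : Ctx 𝒜 s} {e : Tm s .r} {A : Ty 𝒜 s} :
    TypedR Γ e A Δ → ∀ {σ τ : ℕ → SymTm}, Realizes Ty.lset Γ σ → Realizes Ty.rset Δ τ →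
      e.toSym σ τ ∈ A.rset
  | .var h, _, _, _, hτ => hτ _ _ h
  | .app h h', _, _, hσ, hτ => pair_mem_rset (h.toSym_mem hσ hτ) (h'.toSym_mem hσ hτ)
  | .mutilde h, _, _, hσ, hτ => mu_mem_rset fun v hv => by
      rw [Tm.inst_toSym_up_left]; exact h.sn_toSym (hσ.cons hv) hτ
  | .tilde h, _, _, hσ, hτ => by
      rw [Ty.rset, Ty.interp_neg]; exact h.toSym_mem hσ hτ

theorem TypedC.sn_toSym {s : Calculus} {Γ Δ : Ctx 𝒜 s} {p : Tm s .c} :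
    TypedC p Γ Δ → ∀ {σ τ : ℕ → SymTm}, Realizes Ty.lset Γ σ → Realizes Ty.rset Δ τ →
      SN (p.toSym σ τ)
  | .cut h h', _, _, hσ, hτ => sn_cut_of_mem (h.toSym_mem hσ hτ) (h'.toSym_mem hσ hτ)

end

end Adequacy

theorem calculusStronglyNormalizable (𝒜 : Type u) (s : Calculus) :
    CalculusStronglyNormalizable 𝒜 s := by
  refine ⟨fun Γ Δ t A h => ?_, fun Γ Δ e A h => ?_, fun Γ Δ p h => ?_⟩
  · obtain ⟨_, _, hA⟩ := A.exists_isCand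
    exact stronglyNormalizable_of_sn_toSym
      (hA.sn (h.toSym_mem (realizes_lset_var Γ) (realizes_rset_var Δ)))
  · obtain ⟨_, _, hA⟩ := A.exists_isCand
    exact stronglyNormalizable_of_sn_toSym
      (hA.symm.sn (h.toSym_mem (realizes_lset_var Γ) (realizes_rset_var Δ)))
  · exact stronglyNormalizable_of_sn_toSym
      (h.sn_toSym (realizes_lset_var Γ) (realizes_rset_var Δ))

end LMM

/-- The typed `λμμ̃*`-calculus is strongly normalizable, and so is the typed `λμμ̃`-calculus. -/
theorem mainTheorem4 (𝒜 : Type*) :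
    LMM.CalculusStronglyNormalizable 𝒜 LMM.Calculus.star ∧
      LMM.CalculusStronglyNormalizable 𝒜 LMM.Calculus.base :=
  ⟨LMM.calculusStronglyNormalizable 𝒜 _, LMM.calculusStronglyNormalizable 𝒜 _⟩
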